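/- Work in $\mathbf{Hilb}$, the monoidal category of finite-dimensional complex Hilbert spaces and linear maps, with tensor unit $\mathbb{C}$ and with $f^\dagger$ the adjoint of $f$. Write $A^*$ for the dual Hilbert space of $A$ (with $A^{**}=A$, $\mathbb{C}^*=\mathbb{C}$, $(A\otimes B)^*=B^*\otimes A^*$), $f^*:B^*\to A^*$ for the transpose of $f:A\to B$ and $f_*:=(f^*)^\dagger:A^*\to B^*$ for its conjugate; let $\eta_A:A\otimes A^*\to\mathbb{C}$, $a\otimes\varphi\mapsto\varphi(a)$, and $\varepsilon_A:=(\eta_{A^*})^\dagger:\mathbb{C}\to A^*\otimes A$. A linear map $f$ is unitary if $f^\dagger f=\mathrm{id}$ and $ff^\dagger=\mathrm{id}$. An involution monoid $(A,m,u;s)$ consists of an associative unital monoid $m:A\otimes A\to A$, $u:\mathbb{C}\to A$ and a linear map $s:A\to A^*$ which is a morphism of monoids to $(A^*,m_*,u_*)$ and satisfies $s_*\circ s=\mathrm{id}_A$. A homomorphism $f:(A,m,u;s)\to(B,n,v;t)$ is a linear map with $f\circ m=n\circ(f\otimes f)$, $f\circ u=v$ and $t\circ f=f_*\circ s$; an isomorphism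 is a homomorphism with a two-sided inverse homomorphism. The monoid $(A,m,u)$ is $\dagger$-Frobenius if $(m\otimes\mathrm{id})\circ(\mathrm{id}\otimes m^\dagger)=m^\dagger\circ m=(\mathrm{id}\otimes m)\circ(m^\dagger\otimes\mathrm{id})$; its counit is $u^\dagger:A\to\mathbb{C}$, and its left and right involutions $A\to A^*$ are $s_L=((u^\dagger\circ m)\otimes\mathrm{id}_{A^*})\circ(\mathrm{id}_A\otimes\varepsilon_{A^*})$ and $s_R=(\mathrm{id}_{A^*}\otimes(u^\dagger\circ m))\circ(\varepsilon_A\otimes\mathrm{id}_A)$. A special unitary $\dagger$-Frobenius involution monoid is an involution monoid $(A,m,u;s)$ such that $(A,m,u)$ is $\dagger$-Frobenius, $s$ is its left or its right involution, $s_L$ is unitary, and $m\circ m^\dagger=\mathrm{id}_A$. **Theorem.** Let $f:(A,m,u;s)\to(B,n,v;t)$ be an isomorphism between special unitary $\dagger$-Frobenius involution monoids in $\mathbf{Hilb}$. Then $f$ preserves the counit, $v^\dagger\circ f=u^\dagger$, and $f$ is unitary. -/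

import Mathlib

open scoped TensorProduct

noncomputable section

namespace Hilb

/-! Objects of `Hilb` are finite-dimensional complex inner product spaces, morphisms are linear
maps, `†` is `LinearMap.adjoint`, the tensor product is the Hilbert space tensor product with unit
object `ℂ`, and the dual object `A*` is `StrongDual ℂ A` with the Riesz inner product. -/

universe u v

section Duality

variable {A : Type u} [NormedAddCommGroup A] [InnerProductSpace ℂ A] [FiniteDimensional ℂ A]
variable {B : Type v} [NormedAddCommGroup B] [InnerProductSpace ℂ B] [FiniteDimensional ℂ B]

/-- The inner product on the dual space for which the Riesz map `a ↦ ⟪a, ·⟫` is antiunitary;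
its norm is the operator norm. -/
instance instInnerProductSpaceDual : InnerProductSpace ℂ (StrongDual ℂ A) :=
  haveI : CompleteSpace A := FiniteDimensional.complete ℂ A
  { inner := fun φ ψ =>
      inner ℂ ((InnerProductSpace.toDual ℂ A).symm ψ) ((InnerProductSpace.toDual ℂ A).symm φ)
    norm_sq_eq_re_inner := fun φ => by
      rw [inner_self_eq_norm_sq_to_K, LinearIsometryEquiv.norm_map]
      norm_cast
    conj_inner_symm := fun φ ψ => by
      rw [inner_conj_symm]
    add_left := fun φ ψ χ => by
      rw [map_add, inner_add_right]
    smul_left := fun φ ψ c => by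
      rw [LinearIsometryEquiv.map_smulₛₗ, inner_smul_right] }

/-- `f` is unitary: `f† ∘ f = id` and `f ∘ f† = id`. -/
def IsUnitary (f : A →ₗ[ℂ] B) : Prop :=
  LinearMap.adjoint f ∘ₗ f = LinearMap.id ∧ f ∘ₗ LinearMap.adjoint f = LinearMap.id

/-- The duality functor on morphisms: `f* : B* → A*`, `φ ↦ φ ∘ f`. -/
def transpose (f : A →ₗ[ℂ] B) : StrongDual ℂ B →ₗ[ℂ] StrongDual ℂ A where
  toFun φ := φ.comp (LinearMap.toContinuousLinearMap f)
  map_add' _ _ := rfl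
  map_smul' _ _ := rfl

/-- The conjugation functor on morphisms: `f_* = (f*)† : A* → B*`. -/
def conjugate (f : A →ₗ[ℂ] B) : StrongDual ℂ A →ₗ[ℂ] StrongDual ℂ B :=
  LinearMap.adjoint (transpose f)

variable (A) in
/-- The identification `A ≅ A**`, `a ↦ (φ ↦ φ a)`. -/
def toDoubleDual : A →ₗ[ℂ] StrongDual ℂ (StrongDual ℂ A) :=
  (NormedSpace.inclusionInDoubleDual ℂ A).toLinearMap

/-- The identification `ℂ ≅ ℂ*` of the unit object with its dual, `z ↦ (w ↦ z * w)`. -/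
def unitDual : ℂ →ₗ[ℂ] StrongDual ℂ ℂ :=
  (ContinuousLinearMap.mul ℂ ℂ).toLinearMap

variable (A B) in
/-- The order-reversing identification `B* ⊗ A* ≅ (A ⊗ B)*`, `φ ⊗ ψ ↦ (a ⊗ b ↦ ψ a * φ b)`. -/
def tensorDual : StrongDual ℂ B ⊗[ℂ] StrongDual ℂ A →ₗ[ℂ] StrongDual ℂ (A ⊗[ℂ] B) :=
  LinearMap.toContinuousLinearMap.toLinearMap ∘ₗ
    TensorProduct.dualDistrib ℂ A B ∘ₗ
    TensorProduct.map (ContinuousLinearMap.coeLM ℂ) (ContinuousLinearMap.coeLM ℂ) ∘ₗ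
    (TensorProduct.comm ℂ (StrongDual ℂ B) (StrongDual ℂ A)).toLinearMap

variable (A) in
/-- The duality morphism `η_A : A ⊗ A* → ℂ`, `a ⊗ φ ↦ φ a`. -/
def cap : A ⊗[ℂ] StrongDual ℂ A →ₗ[ℂ] ℂ :=
  TensorProduct.lift (ContinuousLinearMap.coeLM ℂ : StrongDual ℂ A →ₗ[ℂ] A →ₗ[ℂ] ℂ).flip

variable (A) in
/-- The duality morphism `η_{A*} : A* ⊗ A → ℂ`, `φ ⊗ a ↦ φ a` (with `A** = A`). -/
def capDual : StrongDual ℂ A ⊗[ℂ] A →ₗ[ℂ] ℂ :=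
  TensorProduct.lift (ContinuousLinearMap.coeLM ℂ : StrongDual ℂ A →ₗ[ℂ] A →ₗ[ℂ] ℂ)

variable (A) in
/-- The duality morphism `ε_A = (η_{A*})† : ℂ → A* ⊗ A`. -/
def cup : ℂ →ₗ[ℂ] StrongDual ℂ A ⊗[ℂ] A :=
  LinearMap.adjoint (𝕜 := ℂ) (E := StrongDual ℂ A ⊗[ℂ] A) (F := ℂ) (capDual A)

variable (A) in
/-- The duality morphism `ε_{A*} = (η_A)† : ℂ → A ⊗ A*` (with `A** = A`). -/
def cupDual : ℂ →ₗ[ℂ] A ⊗[ℂ] StrongDual ℂ A :=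
  LinearMap.adjoint (𝕜 := ℂ) (E := A ⊗[ℂ] StrongDual ℂ A) (F := ℂ) (cap A)

end Duality

section Structures

/-- A monoid `(A, m, u)` in `Hilb`. -/
structure MonoidObj (A : Type u) [NormedAddCommGroup A] [InnerProductSpace ℂ A] where
  /-- multiplication -/
  m : A ⊗[ℂ] A →ₗ[ℂ] A
  /-- unit -/
  u : ℂ →ₗ[ℂ] A
  assoc : m ∘ₗ m.rTensor A = m ∘ₗ m.lTensor A ∘ₗ (TensorProduct.assoc ℂ A A A).toLinearMap
  unit_left : m ∘ₗ u.rTensor A = (TensorProduct.lid ℂ A).toLinearMap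
  unit_right : m ∘ₗ u.lTensor A = (TensorProduct.rid ℂ A).toLinearMap

/-- A comonoid `(A, n, v)` in `Hilb`. -/
structure ComonoidObj (A : Type u) [NormedAddCommGroup A] [InnerProductSpace ℂ A] where
  /-- comultiplication -/
  n : A →ₗ[ℂ] A ⊗[ℂ] A
  /-- counit -/
  v : A →ₗ[ℂ] ℂ
  coassoc : (TensorProduct.assoc ℂ A A A).toLinearMap ∘ₗ n.rTensor A ∘ₗ n = n.lTensor A ∘ₗ n
  counit_left : v.rTensor A ∘ₗ n = (TensorProduct.lid ℂ A).symm.toLinearMap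
  counit_right : v.lTensor A ∘ₗ n = (TensorProduct.rid ℂ A).symm.toLinearMap

variable {A : Type u} [NormedAddCommGroup A] [InnerProductSpace ℂ A]
variable {B : Type v} [NormedAddCommGroup B] [InnerProductSpace ℂ B]

/-- A monoid and a comonoid on `A` form a Frobenius structure:
`(m ⊗ id) ∘ (id ⊗ n) = n ∘ m = (id ⊗ m) ∘ (n ⊗ id)`. -/
def IsFrobeniusStructure (M : MonoidObj A) (N : ComonoidObj A) : Prop :=
  M.m.rTensor A ∘ₗ (TensorProduct.assoc ℂ A A A).symm.toLinearMap ∘ₗ N.n.lTensor A = N.n ∘ₗ M.m ∧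
  N.n ∘ₗ M.m = M.m.lTensor A ∘ₗ (TensorProduct.assoc ℂ A A A).toLinearMap ∘ₗ N.n.rTensor A

variable [FiniteDimensional ℂ A] [FiniteDimensional ℂ B]

/-- The adjoint comonoid `(A, m†, u†)` of a monoid `(A, m, u)`. -/
def MonoidObj.adjoint (M : MonoidObj A) : ComonoidObj A where
  n := LinearMap.adjoint M.m
  v := LinearMap.adjoint M.u
  coassoc := by
    rw [← LinearMap.adjoint_rTensor, ← LinearMap.adjoint_lTensor,
      ← TensorProduct.toLinearEquiv_assocIsometry,
      ← (TensorProduct.assocIsometry ℂ A A A).symm_symm,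
      ← LinearIsometryEquiv.adjoint_toLinearMap_eq_symm]
    simp_rw [← LinearMap.adjoint_comp]
    congr 1
    rw [M.assoc]
    ext
    simp
  counit_left := by
    have h := congrArg LinearMap.adjoint M.unit_left
    rw [LinearMap.adjoint_comp, LinearMap.adjoint_rTensor,
      ← TensorProduct.toLinearEquiv_lidIsometry,
      LinearIsometryEquiv.adjoint_toLinearMap_eq_symm] at h
    exact h
  counit_right := by
    have h := congrArg LinearMap.adjoint M.unit_right
    rw [LinearMap.adjoint_comp, LinearMap.adjoint_lTensor,
      ← TensorProduct.toLinearEquiv_ridIsometry,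
      LinearIsometryEquiv.adjoint_toLinearMap_eq_symm] at h
    exact h

/-- The counit `u† : A → ℂ` of a monoid. -/
def MonoidObj.counit (M : MonoidObj A) : A →ₗ[ℂ] ℂ :=
  M.adjoint.v

/-- The comultiplication `m† : A → A ⊗ A` of a monoid. -/
def MonoidObj.comul (M : MonoidObj A) : A →ₗ[ℂ] A ⊗[ℂ] A :=
  M.adjoint.n

/-- `(A, m, u)` is a †-Frobenius monoid. -/
def MonoidObj.IsDaggerFrobenius (M : MonoidObj A) : Prop :=
  IsFrobeniusStructure M M.adjoint

/-- The left involution `s_L = ((u† ∘ m) ⊗ id_{A*}) ∘ (id_A ⊗ ε_{A*}) : A → A*`. -/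
def MonoidObj.leftInvolution (M : MonoidObj A) : A →ₗ[ℂ] StrongDual ℂ A :=
  (TensorProduct.lid ℂ (StrongDual ℂ A)).toLinearMap ∘ₗ
    (M.counit ∘ₗ M.m).rTensor (StrongDual ℂ A) ∘ₗ
    (TensorProduct.assoc ℂ A A (StrongDual ℂ A)).symm.toLinearMap ∘ₗ
    (cupDual A).lTensor A ∘ₗ
    (TensorProduct.rid ℂ A).symm.toLinearMap

/-- The right involution `s_R = (id_{A*} ⊗ (u† ∘ m)) ∘ (ε_A ⊗ id_A) : A → A*`. -/
def MonoidObj.rightInvolution (M : MonoidObj A) : A →ₗ[ℂ] StrongDual ℂ A :=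
  (TensorProduct.rid ℂ (StrongDual ℂ A)).toLinearMap ∘ₗ
    (M.counit ∘ₗ M.m).lTensor (StrongDual ℂ A) ∘ₗ
    (TensorProduct.assoc ℂ (StrongDual ℂ A) A A).toLinearMap ∘ₗ
    (cup A).rTensor A ∘ₗ
    (TensorProduct.lid ℂ A).symm.toLinearMap

/-- A †-Frobenius monoid is unitary if its left involution is unitary. -/
def MonoidObj.IsUnitaryMonoid (M : MonoidObj A) : Prop :=
  IsUnitary M.leftInvolution

/-- A †-Frobenius monoid is special if `m ∘ m† = id`. -/
def MonoidObj.IsSpecial (M : MonoidObj A) : Prop :=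
  M.m ∘ₗ M.comul = LinearMap.id

/-- The multiplication `m_* : A* ⊗ A* → A*` of the conjugate monoid on `A*`. -/
def MonoidObj.conjMul (M : MonoidObj A) : StrongDual ℂ A ⊗[ℂ] StrongDual ℂ A →ₗ[ℂ] StrongDual ℂ A :=
  conjugate M.m ∘ₗ tensorDual A A

/-- The unit `u_* : ℂ → A*` of the conjugate monoid on `A*`. -/
def MonoidObj.conjUnit (M : MonoidObj A) : ℂ →ₗ[ℂ] StrongDual ℂ A :=
  conjugate M.u ∘ₗ unitDual

end Structures

section Involution

/-- An involution monoid `(A, m, u; s)`: a monoid with a linear involution `s : A → A*` which is a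
morphism of monoids to the conjugate monoid `(A*, m_*, u_*)` and satisfies `s_* ∘ s = id_A`
(read through `A ≅ A**`). -/
structure InvolutionMonoid (A : Type u) [NormedAddCommGroup A] [InnerProductSpace ℂ A]
    [FiniteDimensional ℂ A] extends MonoidObj A where
  /-- linear involution -/
  s : A →ₗ[ℂ] StrongDual ℂ A
  s_mul : s ∘ₗ m = toMonoidObj.conjMul ∘ₗ TensorProduct.map s s
  s_unit : s ∘ₗ u = toMonoidObj.conjUnit
  involutive : conjugate s ∘ₗ s = toDoubleDual A

variable {A : Type u} [NormedAddCommGroup A] [InnerProductSpace ℂ A] [FiniteDimensional ℂ A]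
variable {B : Type v} [NormedAddCommGroup B] [InnerProductSpace ℂ B] [FiniteDimensional ℂ B]

/-- `f : A → B` is a homomorphism of involution monoids: it preserves multiplication and unit, and
`s_B ∘ f = f_* ∘ s_A`. -/
structure IsHom (M : InvolutionMonoid A) (N : InvolutionMonoid B) (f : A →ₗ[ℂ] B) : Prop where
  map_mul : f ∘ₗ M.m = N.m ∘ₗ TensorProduct.map f f
  map_unit : f ∘ₗ M.u = N.u
  map_involution : N.s ∘ₗ f = conjugate f ∘ₗ M.s

/-- `f` is an isomorphism of involution monoids: a homomorphism with a two-sided inverse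
homomorphism. -/
def IsIso (M : InvolutionMonoid A) (N : InvolutionMonoid B) (f : A →ₗ[ℂ] B) : Prop :=
  IsHom M N f ∧ ∃ g : B →ₗ[ℂ] A, IsHom N M g ∧ g ∘ₗ f = LinearMap.id ∧ f ∘ₗ g = LinearMap.id

/-- `(A, m, u; s)` is a †-Frobenius left-involution monoid. -/
def InvolutionMonoid.IsDaggerFrobeniusLeft (M : InvolutionMonoid A) : Prop :=
  M.toMonoidObj.IsDaggerFrobenius ∧ M.s = M.toMonoidObj.leftInvolution

/-- `(A, m, u; s)` is a †-Frobenius right-involution monoid. -/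
def InvolutionMonoid.IsDaggerFrobeniusRight (M : InvolutionMonoid A) : Prop :=
  M.toMonoidObj.IsDaggerFrobenius ∧ M.s = M.toMonoidObj.rightInvolution

/-- `(A, m, u; s)` is a special unitary †-Frobenius involution monoid: a †-Frobenius left- or
right-involution monoid which is unitary (so that the left and right involutions coincide) and
special. -/
structure InvolutionMonoid.IsSpecialUnitaryDaggerFrobenius (M : InvolutionMonoid A) : Prop where
  frobenius : M.IsDaggerFrobeniusLeft ∨ M.IsDaggerFrobeniusRight
  unitary : M.toMonoidObj.IsUnitaryMonoid
  special : M.toMonoidObj.IsSpecial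

/-- `f` preserves the counit: `v† ∘ f = u†`. -/
def PreservesCounit (M : InvolutionMonoid A) (N : InvolutionMonoid B) (f : A →ₗ[ℂ] B) : Prop :=
  N.toMonoidObj.counit ∘ₗ f = M.toMonoidObj.counit

end Involution

end Hilb

end

namespace Hilb

open scoped InnerProductSpace ComplexConjugate

universe u v

/-! ### Riesz vectors, conjugates and cups -/

section Duality

variable {A : Type u} [NormedAddCommGroup A] [InnerProductSpace ℂ A] [FiniteDimensional ℂ A]
variable {B : Type v} [NormedAddCommGroup B] [InnerProductSpace ℂ B] [FiniteDimensional ℂ B]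

/-! Through the Riesz map, `s` becomes an antilinear involution `a ↦ a⋆`, and the inner product is
recovered from algebraic data as `⟪a, b⟫ = ε(a⋆ b)` with `ε = u†` (`inner_eq_counit`). Unitarity
makes `⋆` antiunitary, hence `ε` tracial. For an orthonormal basis `e i`, one finds `m†(1) = ∑ e i ⊗
(e i)⋆`, so specialness gives `∑ e i (e i)⋆ = 1`. Therefore `tr(L_a) = ∑ ε((e i)⋆ a (e i)) = ε(a ∑ e
i (e i)⋆) = ε(a)` (`counit_eq_trace`). The trace of left multiplication is invariant under monoid
isomorphism, so `f` preserves `ε`. Since `f` also preserves products and `⋆`, it preserves the inner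
product. -/

/-- The vector representing a functional: `φ = ⟪riesz φ, ·⟫`. -/
noncomputable def riesz (φ : StrongDual ℂ A) : A :=
  haveI : CompleteSpace A := FiniteDimensional.complete ℂ A
  (InnerProductSpace.toDual ℂ A).symm φ

/-- The functional `⟪a, ·⟫`. -/
noncomputable def bra (a : A) : StrongDual ℂ A :=
  haveI : CompleteSpace A := FiniteDimensional.complete ℂ A
  InnerProductSpace.toDual ℂ A a

theorem inner_riesz (φ : StrongDual ℂ A) (b : A) : ⟪riesz φ, b⟫_ℂ = φ b := by
  have : CompleteSpace A := FiniteDimensional.complete ℂ A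
  exact InnerProductSpace.toDual_symm_apply

theorem bra_apply (a b : A) : bra a b = ⟪a, b⟫_ℂ := rfl

theorem bra_riesz (φ : StrongDual ℂ A) : bra (riesz φ) = φ := by
  ext b
  rw [bra_apply, inner_riesz]

theorem riesz_bra (a : A) : riesz (bra a) = a := by
  refine ext_inner_right ℂ fun b => ?_
  rw [inner_riesz, bra_apply]

theorem inner_dual (φ ψ : StrongDual ℂ A) : ⟪φ, ψ⟫_ℂ = ⟪riesz ψ, riesz φ⟫_ℂ := rfl

theorem inner_dual_bra (φ : StrongDual ℂ A) (a : A) : ⟪φ, bra a⟫_ℂ = conj (φ a) := by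
  rw [inner_dual, riesz_bra, ← inner_riesz, inner_conj_symm]

/-- Under the antilinear Riesz identification `f_*` is just `f`; this turns the conditions on `s`
into conditions on `⋆`. -/
theorem conjugate_bra (f : A →ₗ[ℂ] B) (a : A) : conjugate f (bra a) = bra (f a) := by
  refine ext_inner_left ℂ fun φ => ?_
  rw [conjugate, LinearMap.adjoint_inner_right, inner_dual_bra, inner_dual_bra]
  rfl

/-- Pure tensors span, so they suffice to identify a vector by inner products. Used for both cups
and for `m†(1)`. -/
theorem adjoint_apply_eq_sum_tmul {E F G ι : Type*} [Fintype ι]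
    [NormedAddCommGroup E] [InnerProductSpace ℂ E] [FiniteDimensional ℂ E]
    [NormedAddCommGroup F] [InnerProductSpace ℂ F] [FiniteDimensional ℂ F]
    [NormedAddCommGroup G] [InnerProductSpace ℂ G] [FiniteDimensional ℂ G]
    (c : E ⊗[ℂ] F →ₗ[ℂ] G) (z : G) (x : ι → E) (y : ι → F)
    (h : ∀ a b, ⟪c (a ⊗ₜ b), z⟫_ℂ = ∑ i, ⟪a, x i⟫_ℂ * ⟪b, y i⟫_ℂ) :
    LinearMap.adjoint c z = ∑ i, x i ⊗ₜ y i := by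
  refine ext_inner_left ℂ fun t => ?_
  rw [LinearMap.adjoint_inner_right]
  induction t with
  | zero => simp
  | add x y hx hy => rw [map_add, inner_add_left, inner_add_left, hx, hy]
  | tmul a b => simp only [h, inner_sum, TensorProduct.inner_tmul]

theorem cupDual_one {ι : Type*} [Fintype ι] (e : OrthonormalBasis ι ℂ A) :
    cupDual A 1 = ∑ i, e i ⊗ₜ bra (e i) := by
  refine adjoint_apply_eq_sum_tmul (cap A) 1 _ _ fun a φ => ?_
  simp_rw [inner_dual, riesz_bra, e.sum_inner_mul_inner, ← inner_conj_symm a, inner_riesz]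
  exact one_mul _

theorem cup_one {ι : Type*} [Fintype ι] (e : OrthonormalBasis ι ℂ A) :
    cup A 1 = ∑ i, bra (e i) ⊗ₜ e i := by
  refine adjoint_apply_eq_sum_tmul (capDual A) 1 _ _ fun φ a => ?_
  simp_rw [inner_dual, riesz_bra, mul_comm, e.sum_inner_mul_inner, ← inner_conj_symm a,
    inner_riesz]
  exact one_mul _

end Duality

/-! ### Multiplication, counit and the two involutions as pairings -/

section Monoid

variable {A : Type u} [NormedAddCommGroup A] [InnerProductSpace ℂ A]

/-- The multiplication of a monoid as a bilinear map; its value at `a` is left multiplication. -/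
noncomputable def MonoidObj.mul (M : MonoidObj A) : A →ₗ[ℂ] A →ₗ[ℂ] A :=
  TensorProduct.curry M.m

theorem MonoidObj.m_tmul (M : MonoidObj A) (a b : A) : M.m (a ⊗ₜ b) = M.mul a b := rfl

theorem MonoidObj.mul_assoc (M : MonoidObj A) (a b c : A) :
    M.mul (M.mul a b) c = M.mul a (M.mul b c) :=
  LinearMap.congr_fun M.assoc (a ⊗ₜ b ⊗ₜ c)

theorem MonoidObj.mul_unit (M : MonoidObj A) (a : A) : M.mul a (M.u 1) = a := by
  have h := LinearMap.congr_fun M.unit_right (a ⊗ₜ 1)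
  rwa [LinearMap.comp_apply, LinearMap.lTensor_tmul, LinearEquiv.coe_coe, TensorProduct.rid_tmul,
    one_smul] at h

variable [FiniteDimensional ℂ A]

theorem MonoidObj.counit_apply (M : MonoidObj A) (a : A) : M.counit a = ⟪M.u 1, a⟫_ℂ := by
  have h := LinearMap.adjoint_inner_right M.u 1 a
  rw [← h]
  simp [MonoidObj.counit, MonoidObj.adjoint]

theorem MonoidObj.leftInvolution_apply (M : MonoidObj A) (a b : A) :
    M.leftInvolution a b = M.counit (M.mul a b) := by
  let e := stdOrthonormalBasis ℂ A
  have h : M.leftInvolution a = ∑ i, M.counit (M.mul a (e i)) • bra (e i) := by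
    simp [MonoidObj.leftInvolution, cupDual_one e, TensorProduct.tmul_sum, MonoidObj.m_tmul]
  rw [h]
  conv_rhs => rw [← e.sum_repr' b]
  simp [bra_apply, mul_comm]

theorem MonoidObj.rightInvolution_apply (M : MonoidObj A) (a b : A) :
    M.rightInvolution a b = M.counit (M.mul b a) := by
  let e := stdOrthonormalBasis ℂ A
  have h : M.rightInvolution a = ∑ i, M.counit (M.mul (e i) a) • bra (e i) := by
    simp [MonoidObj.rightInvolution, cup_one e, TensorProduct.sum_tmul, MonoidObj.m_tmul]
  rw [h]
  conv_rhs => rw [← e.sum_repr' b]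
  simp [bra_apply, mul_comm]

end Monoid

/-! ### The antilinear star and the trace formula -/

section Involution

variable {A : Type u} [NormedAddCommGroup A] [InnerProductSpace ℂ A] [FiniteDimensional ℂ A]
variable {B : Type v} [NormedAddCommGroup B] [InnerProductSpace ℂ B] [FiniteDimensional ℂ B]

/-- The antilinear involution `a ↦ a⋆` of an involution monoid, `s a = ⟪a⋆, ·⟫`. -/
noncomputable def InvolutionMonoid.conjStar (M : InvolutionMonoid A) (a : A) : A :=
  riesz (M.s a)

theorem InvolutionMonoid.bra_conjStar (M : InvolutionMonoid A) (a : A) :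
    bra (M.conjStar a) = M.s a :=
  bra_riesz _

theorem InvolutionMonoid.conjStar_conjStar (M : InvolutionMonoid A) (a : A) :
    M.conjStar (M.conjStar a) = a := by
  refine ext_inner_left ℂ fun b => ?_
  have h := DFunLike.congr_fun (LinearMap.congr_fun M.involutive a) (bra b)
  rw [LinearMap.comp_apply, ← M.bra_conjStar a, conjugate_bra, bra_apply, inner_dual,
    riesz_bra] at h
  exact h

theorem IsHom.map_conjStar {M : InvolutionMonoid A} {N : InvolutionMonoid B} {f : A →ₗ[ℂ] B}
    (hf : IsHom M N f) (a : A) : N.conjStar (f a) = f (M.conjStar a) := by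
  have h := LinearMap.congr_fun hf.map_involution a
  rw [LinearMap.comp_apply, LinearMap.comp_apply, ← M.bra_conjStar, conjugate_bra] at h
  rw [InvolutionMonoid.conjStar, h, riesz_bra]

theorem IsHom.map_mul_apply {M : InvolutionMonoid A} {N : InvolutionMonoid B} {f : A →ₗ[ℂ] B}
    (hf : IsHom M N f) (a b : A) : f (M.mul a b) = N.mul (f a) (f b) :=
  LinearMap.congr_fun hf.map_mul (a ⊗ₜ b)

theorem IsUnitary.inner_map_map {f : A →ₗ[ℂ] B} (hf : IsUnitary f) (a b : A) :
    ⟪f a, f b⟫_ℂ = ⟪a, b⟫_ℂ := by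
  rw [← LinearMap.adjoint_inner_right, ← LinearMap.comp_apply, hf.1, LinearMap.id_apply]

namespace InvolutionMonoid.IsSpecialUnitaryDaggerFrobenius

variable {M : InvolutionMonoid A}

/-- Unitarity forces the left and right involutions to agree with the given one. -/
theorem s_eq_leftInvolution (hM : M.IsSpecialUnitaryDaggerFrobenius) :
    M.s = M.leftInvolution := by
  rcases hM.frobenius with h | h
  · exact h.2
  -- When `s = s_R`, test against `s_L b`: unitarity gives `⟪s_L b, s_L a⋆⟫ = ⟪b, a⋆⟫`, and `(s_L b)
  -- a = ε(ba) = (s_R a) b = ⟪a⋆, b⟫`, whose conjugate is the same number.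
  have hL : ∀ a, M.leftInvolution (M.conjStar a) = bra a := by
    intro a
    have hsurj : Function.Surjective M.leftInvolution := fun φ =>
      ⟨LinearMap.adjoint M.leftInvolution φ, LinearMap.congr_fun hM.unitary.2 φ⟩
    refine ext_inner_left ℂ fun φ => ?_
    obtain ⟨b, rfl⟩ := hsurj φ
    rw [hM.unitary.inner_map_map, inner_dual_bra, MonoidObj.leftInvolution_apply,
      ← MonoidObj.rightInvolution_apply, ← h.2, ← M.bra_conjStar, bra_apply, inner_conj_symm]
  refine LinearMap.ext fun a => ?_
  rw [← M.bra_conjStar, ← hL, M.conjStar_conjStar]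

theorem inner_conjStar (hM : M.IsSpecialUnitaryDaggerFrobenius) (a b : A) :
    ⟪M.conjStar a, b⟫_ℂ = M.counit (M.mul a b) := by
  rw [← MonoidObj.leftInvolution_apply, ← hM.s_eq_leftInvolution, ← M.bra_conjStar, bra_apply]

theorem inner_eq_counit (hM : M.IsSpecialUnitaryDaggerFrobenius) (a b : A) :
    ⟪a, b⟫_ℂ = M.counit (M.mul (M.conjStar a) b) := by
  rw [← hM.inner_conjStar, M.conjStar_conjStar]

/-- The star is the unitary `s_L` followed by the antiunitary Riesz map. -/
theorem inner_conjStar_conjStar (hM : M.IsSpecialUnitaryDaggerFrobenius) (a b : A) :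
    ⟪M.conjStar a, M.conjStar b⟫_ℂ = ⟪b, a⟫_ℂ := by
  rw [conjStar, conjStar, ← inner_dual, hM.s_eq_leftInvolution, hM.unitary.inner_map_map]

/-- Antiunitarity of the star: `ε(ab) = ⟪a⋆, b⟫ = ⟪b⋆, a⟫ = ε(ba)`. -/
theorem counit_mul_comm (hM : M.IsSpecialUnitaryDaggerFrobenius) (a b : A) :
    M.counit (M.mul a b) = M.counit (M.mul b a) := by
  rw [← hM.inner_conjStar, ← hM.inner_conjStar, ← hM.inner_conjStar_conjStar b,
    M.conjStar_conjStar]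

/-- Traciality gives `⟪ab, 1⟫ = ⟪a, b⋆⟫`, which is then expanded in the basis. -/
theorem comul_unit (hM : M.IsSpecialUnitaryDaggerFrobenius) {ι : Type*} [Fintype ι]
    (e : OrthonormalBasis ι ℂ A) : M.comul (M.u 1) = ∑ i, e i ⊗ₜ M.conjStar (e i) := by
  refine adjoint_apply_eq_sum_tmul M.m (M.u 1) _ _ fun a b => ?_
  have h (i : ι) : ⟪b, M.conjStar (e i)⟫_ℂ = ⟪e i, M.conjStar b⟫_ℂ := by
    rw [← hM.inner_conjStar_conjStar, M.conjStar_conjStar]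
  simp only [h, e.sum_inner_mul_inner]
  rw [MonoidObj.m_tmul, ← inner_conj_symm, ← MonoidObj.counit_apply, hM.counit_mul_comm,
    ← hM.inner_conjStar, inner_conj_symm]

/-- Specialness, evaluated at the unit; it fixes the normalisation of the counit. -/
theorem sum_mul_conjStar (hM : M.IsSpecialUnitaryDaggerFrobenius) {ι : Type*} [Fintype ι]
    (e : OrthonormalBasis ι ℂ A) : ∑ i, M.mul (e i) (M.conjStar (e i)) = M.u 1 := by
  have h := LinearMap.congr_fun hM.special (M.u 1)
  rw [LinearMap.comp_apply, hM.comul_unit e, map_sum] at h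
  exact h

/-- The counit is the trace of the left regular representation. -/
theorem counit_eq_trace (hM : M.IsSpecialUnitaryDaggerFrobenius) (a : A) :
    M.counit a = LinearMap.trace ℂ A (M.mul a) := by
  let e := stdOrthonormalBasis ℂ A
  -- Cyclicity moves `(e i)⋆` from the far left to the far right.
  have h (i) : ⟪e i, M.mul a (e i)⟫_ℂ = M.counit (M.mul a (M.mul (e i) (M.conjStar (e i)))) := by
    rw [hM.inner_eq_counit, hM.counit_mul_comm, MonoidObj.mul_assoc]
  rw [LinearMap.trace_eq_sum_inner _ e]
  simp_rw [h]
  rw [← map_sum, ← map_sum, hM.sum_mul_conjStar, MonoidObj.mul_unit]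

end InvolutionMonoid.IsSpecialUnitaryDaggerFrobenius

/-! ### Isomorphisms -/

theorem IsIso.preservesCounit {M : InvolutionMonoid A} {N : InvolutionMonoid B}
    (hM : M.IsSpecialUnitaryDaggerFrobenius) (hN : N.IsSpecialUnitaryDaggerFrobenius)
    {f : A →ₗ[ℂ] B} (hf : IsIso M N f) : PreservesCounit M N f := by
  obtain ⟨hf, g, -, hgf, hfg⟩ := hf
  refine LinearMap.ext fun a => ?_
  -- Left multiplications are conjugate under `f`, hence have equal trace.
  have h : N.mul (f a) = f ∘ₗ M.mul a ∘ₗ g := by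
    refine LinearMap.ext fun b => ?_
    have hb : f (g b) = b := LinearMap.congr_fun hfg b
    simp only [LinearMap.comp_apply, hf.map_mul_apply, hb]
  rw [LinearMap.comp_apply, hN.counit_eq_trace, hM.counit_eq_trace, h, LinearMap.trace_comp_comm',
    LinearMap.comp_assoc, hgf, LinearMap.comp_id]

theorem IsIso.isUnitary {M : InvolutionMonoid A} {N : InvolutionMonoid B}
    (hM : M.IsSpecialUnitaryDaggerFrobenius) (hN : N.IsSpecialUnitaryDaggerFrobenius)
    {f : A →ₗ[ℂ] B} (hf : IsIso M N f) : IsUnitary f := by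
  have hc (a : A) : N.counit (f a) = M.counit a :=
    LinearMap.congr_fun (hf.preservesCounit hM hN) a
  obtain ⟨hf, g, -, hgf, hfg⟩ := hf
  have h : LinearMap.adjoint f ∘ₗ f = LinearMap.id := by
    refine LinearMap.ext fun a => ext_inner_left ℂ fun b => ?_
    rw [LinearMap.comp_apply, LinearMap.adjoint_inner_right, hN.inner_eq_counit, hf.map_conjStar,
      ← hf.map_mul_apply, hc, ← hM.inner_eq_counit, LinearMap.id_apply]
  -- The isometry `f` has right inverse `g`, which its left inverse `f†` must equal.
  have hg : LinearMap.adjoint f = g := by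
    rw [← LinearMap.comp_id (LinearMap.adjoint f), ← hfg, ← LinearMap.comp_assoc, h,
      LinearMap.id_comp]
  exact ⟨h, by rw [hg, hfg]⟩

end Involution

end Hilb

theorem mainTheorem5 {A : Type*} [NormedAddCommGroup A] [InnerProductSpace ℂ A]
    [FiniteDimensional ℂ A] {B : Type*} [NormedAddCommGroup B] [InnerProductSpace ℂ B]
    [FiniteDimensional ℂ B] (M : Hilb.InvolutionMonoid A) (N : Hilb.InvolutionMonoid B)
    (hM : M.IsSpecialUnitaryDaggerFrobenius) (hN : N.IsSpecialUnitaryDaggerFrobenius)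
    (f : A →ₗ[ℂ] B) (hf : Hilb.IsIso M N f) :
    Hilb.PreservesCounit M N f ∧ Hilb.IsUnitary f :=
  ⟨hf.preservesCounit hM hN, hf.isUnitary hM hN⟩
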